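/- Let $(X,\mu)$ be a standard $\sigma$-finite measure space. A set $A\subseteq X\times X$ is marginally null if $A\subseteq (M\times X)\cup(X\times M)$ for some null set $M$; $A\subseteq_\omega B$ means that $A\setminus B$ is marginally null, and $A\cong B$ that the symmetric difference of $A$ and $B$ is marginally null. A rectangle is a set $\alpha\times\beta$ with $\alpha,\beta\subseteq X$ measurable, and a set is $\omega$-open if it is $\cong$ to a countable union of rectangles. The $\omega$-interior $\mathrm{int}_\omega(\kappa)$ is the smallest (up to $\cong$) $\omega$-open set that marginally contains every rectangle $R\subseteq\kappa$, and $\mathrm{cl}_\omega(\kappa)$ is the complement of $\mathrm{int}_\omega(\kappa^c)$. A measurable set $\kappa\subseteq X\times X$ is a positivity domain if $\kappa\cong \mathrm{cl}_\omega(\mathrm{int}_\omega(\kappa))$, $\kappa\cong\{(x,y):(y,x)\in\kappa\}$ and $\{(x,x):x\in X\}\subseteq_\omega\kappa$. For $k\in L^2(X\times X)$ let $T_k$ be the Hilbert-Schmidt operator on $L^2(X,\mu)$ (complex scalars) given by $(T_kf)(y)=\int_X k(y,x)f(x)\,d\mu(x)$, and let $\mathcal S(\kappa)$ be the weak* closure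 in $\mathcal B(L^2(X,\mu))$ of the set of all $T_k$ with $k\in L^2(X\times X)$ vanishing almost everywhere off $\kappa$. **Theorem.** There exists a positivity domain $\kappa\subseteq\mathbb T\times\mathbb T$, where $\mathbb T$ is the circle group with normalised Haar measure, such that $\mathcal S(\kappa)$ contains no positive rank one operator. More precisely, realise $\mathbb T$ as $(-1,1]$ with addition modulo $2$ and normalised Lebesgue measure. Let $(t_n)_{n\ge 1}\subseteq(0,1)$ be any strictly decreasing sequence converging to $0$, and set $$E=\{0\}\cup\bigcup_{n=1}^\infty\big([t_{2n},t_{2n-1}]\cup[-t_{2n-1},-t_{2n}]\big),\qquad E^*=\{(s,t)\in\mathbb T\times\mathbb T : t-s\in E\}.$$ Then $E$ contains no neighbourhood of $0$, the set $E^*$ is a positivity domain, and $\mathcal S(E^*)$ contains no positive rank one operator. -/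

import Mathlib

open MeasureTheory Set Topology Filter
open scoped ENNReal

noncomputable section

namespace PosDomain

/-! ### Marginal equivalence and the ω-topology -/

section Marginal

variable {X : Type*} [MeasurableSpace X]

/-- `A ⊆ X × X` is marginally null: `A ⊆ (M × X) ∪ (X × M)` for some `μ`-null set `M`. -/
def MarginallyNull (μ : Measure X) (A : Set (X × X)) : Prop :=
  ∃ M : Set X, μ M = 0 ∧ A ⊆ (M ×ˢ univ) ∪ (univ ×ˢ M)

/-- Marginal containment: `A \ B` is marginally null. -/
def MarginallyContained (μ : Measure X) (A B : Set (X × X)) : Prop :=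
  MarginallyNull μ (A \ B)

/-- Marginal equivalence: the symmetric difference of `A` and `B` is marginally null. -/
def MarginallyEquiv (μ : Measure X) (A B : Set (X × X)) : Prop :=
  MarginallyNull μ (symmDiff A B)

/-- A rectangle is a product of two measurable subsets of `X`. -/
def IsRectangle (R : Set (X × X)) : Prop :=
  ∃ α β : Set X, MeasurableSet α ∧ MeasurableSet β ∧ R = α ×ˢ β

/-- A set is ω-open if it is marginally equivalent to a countable union of rectangles. -/
def IsOmegaOpen (μ : Measure X) (U : Set (X × X)) : Prop :=
  ∃ R : ℕ → Set (X × X), (∀ n, IsRectangle (R n)) ∧ MarginallyEquiv μ U (⋃ n, R n)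

/-- `U` is (a version of) the ω-union of the collection `𝓔` of ω-open sets: the smallest, up to
marginal equivalence, ω-open set which marginally contains every member of `𝓔`. -/
structure IsOmegaUnion (μ : Measure X) (𝓔 : Set (Set (X × X))) (U : Set (X × X)) : Prop where
  isOmegaOpen : IsOmegaOpen μ U
  upper : ∀ A ∈ 𝓔, MarginallyContained μ A U
  least : ∀ V, IsOmegaOpen μ V → (∀ A ∈ 𝓔, MarginallyContained μ A V) →
    MarginallyContained μ U V

/-- `U` is (a version of) the ω-interior of `κ`: the ω-union of the rectangles contained
in `κ`. -/
def IsOmegaInterior (μ : Measure X) (κ U : Set (X × X)) : Prop :=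
  IsOmegaUnion μ {R | IsRectangle R ∧ R ⊆ κ} U

/-- `W` is (a version of) the ω-closure of `κ`: its complement is the ω-interior of `κᶜ`. -/
def IsOmegaClosure (μ : Measure X) (κ W : Set (X × X)) : Prop :=
  IsOmegaInterior μ κᶜ Wᶜ

/-- `κ` is generated by rectangles: `κ` is marginally equivalent to the ω-closure of its
ω-interior. -/
def GeneratedByRectangles (μ : Measure X) (κ : Set (X × X)) : Prop :=
  ∃ U W, IsOmegaInterior μ κ U ∧ IsOmegaClosure μ U W ∧ MarginallyEquiv μ κ W

/-- A positivity domain is a measurable subset of `X × X` which is generated by rectangles, is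
symmetric up to marginal equivalence, and marginally contains the diagonal. -/
structure IsPositivityDomain (μ : Measure X) (κ : Set (X × X)) : Prop where
  measurableSet : MeasurableSet κ
  generatedByRectangles : GeneratedByRectangles μ κ
  symmetric : MarginallyEquiv μ κ {p | (p.2, p.1) ∈ κ}
  diagonal : MarginallyContained μ (diagonal X) κ

/-- ω-unions (hence ω-interiors and ω-closures) are unique up to marginal equivalence. -/
theorem IsOmegaUnion.unique {μ : Measure X} {𝓔 : Set (Set (X × X))} {U V : Set (X × X)}
    (hU : IsOmegaUnion μ 𝓔 U) (hV : IsOmegaUnion μ 𝓔 V) : MarginallyEquiv μ U V := by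
  obtain ⟨M, hM, h1⟩ := hU.least V hV.isOmegaOpen hV.upper
  obtain ⟨N, hN, h2⟩ := hV.least U hU.isOmegaOpen hU.upper
  refine ⟨M ∪ N, measure_union_null hM hN, ?_⟩
  rintro p (hp | hp)
  · rcases h1 hp with h | h
    · exact Or.inl ⟨Or.inl h.1, trivial⟩
    · exact Or.inr ⟨trivial, Or.inl h.2⟩
  · rcases h2 hp with h | h
    · exact Or.inl ⟨Or.inr h.1, trivial⟩
    · exact Or.inr ⟨trivial, Or.inr h.2⟩

end Marginal

/-! ### Hilbert–Schmidt integral operators on `L²` -/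

section Kernel

variable {X : Type*} [MeasurableSpace X] {μ : Measure X}

lemma aestronglyMeasurable_kernel_mul (k : Lp ℂ 2 (μ.prod μ)) (f : Lp ℂ 2 μ) :
    AEStronglyMeasurable (fun p : X × X => k p * f p.2) (μ.prod μ) :=
  (Lp.aestronglyMeasurable k).mul (Lp.aestronglyMeasurable f).comp_snd

lemma lintegral_enorm_sq {Y : Type*} [MeasurableSpace Y] {ν : Measure Y} (g : Y → ℂ) :
    eLpNorm g 2 ν ^ 2 = ∫⁻ y, ‖g y‖ₑ ^ 2 ∂ν := by
  have h := eLpNorm_nnreal_pow_eq_lintegral (f := g) (μ := ν) (p := 2) (by norm_num)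
  simpa using h

variable [SFinite μ]

lemma enorm_kernel_integral_sq_le (k : Lp ℂ 2 (μ.prod μ)) (f : Lp ℂ 2 μ) :
    ∀ᵐ y ∂μ, ‖∫ x, k (y, x) * f x ∂μ‖ₑ ^ 2 ≤
      (∫⁻ x, ‖k (y, x)‖ₑ ^ 2 ∂μ) * (∫⁻ x, ‖f x‖ₑ ^ 2 ∂μ) := by
  filter_upwards [(Lp.aestronglyMeasurable k).prodMk_left] with y hy
  have h1 : ‖∫ x, k (y, x) * f x ∂μ‖ₑ ≤ ∫⁻ x, ‖k (y, x)‖ₑ * ‖f x‖ₑ ∂μ := by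
    refine (enorm_integral_le_lintegral_enorm _).trans (le_of_eq ?_)
    simp only [enorm_mul]
  have h2 := ENNReal.lintegral_mul_le_Lp_mul_Lq μ Real.HolderConjugate.two_two
    hy.enorm (Lp.aestronglyMeasurable f).enorm
  have h3 := pow_le_pow_left' (h1.trans h2) 2
  refine h3.trans (le_of_eq ?_)
  rw [mul_pow, ← ENNReal.rpow_natCast, ← ENNReal.rpow_natCast, ← ENNReal.rpow_mul,
    ← ENNReal.rpow_mul]
  norm_num

lemma eLpNorm_kernel_integral_le (k : Lp ℂ 2 (μ.prod μ)) (f : Lp ℂ 2 μ) :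
    eLpNorm (fun y => ∫ x, k (y, x) * f x ∂μ) 2 μ ≤
      eLpNorm k 2 (μ.prod μ) * eLpNorm f 2 μ := by
  rw [← ENNReal.pow_le_pow_left_iff (n := 2) (by norm_num), mul_pow, lintegral_enorm_sq,
    lintegral_enorm_sq, lintegral_enorm_sq]
  refine (lintegral_mono_ae (enorm_kernel_integral_sq_le k f)).trans (le_of_eq ?_)
  have hk : AEMeasurable (fun p : X × X => ‖k p‖ₑ ^ 2) (μ.prod μ) :=
    (Lp.aestronglyMeasurable k).enorm.pow_const 2
  rw [lintegral_mul_const'' _ hk.lintegral_prod_right', lintegral_prod _ hk]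

lemma memLp_kernel_integral (k : Lp ℂ 2 (μ.prod μ)) (f : Lp ℂ 2 μ) :
    MemLp (fun y => ∫ x, k (y, x) * f x ∂μ) 2 μ :=
  ⟨(aestronglyMeasurable_kernel_mul k f).integral_prod_right',
    (eLpNorm_kernel_integral_le k f).trans_lt
      (ENNReal.mul_lt_top (Lp.eLpNorm_lt_top k) (Lp.eLpNorm_lt_top f))⟩

lemma integrable_kernel_mul (k : Lp ℂ 2 (μ.prod μ)) :
    ∀ᵐ y ∂μ, ∀ f : Lp ℂ 2 μ, Integrable (fun x => k (y, x) * f x) μ := by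
  have hk : AEMeasurable (fun p : X × X => ‖k p‖ₑ ^ 2) (μ.prod μ) :=
    (Lp.aestronglyMeasurable k).enorm.pow_const 2
  have hfin : ∫⁻ y, ∫⁻ x, ‖k (y, x)‖ₑ ^ 2 ∂μ ∂μ ≠ ∞ := by
    rw [← lintegral_prod _ hk, ← lintegral_enorm_sq]
    exact ENNReal.pow_ne_top (Lp.eLpNorm_ne_top k)
  filter_upwards [(Lp.aestronglyMeasurable k).prodMk_left,
    ae_lt_top' hk.lintegral_prod_right' hfin] with y hy hlt f
  have hm : MemLp (fun x => k (y, x)) 2 μ := by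
    refine ⟨hy, ?_⟩
    by_contra hcon
    rw [not_lt, top_le_iff] at hcon
    have := lintegral_enorm_sq (ν := μ) (fun x => k (y, x))
    rw [hcon] at this
    simp at this
    exact hlt.ne this.symm
  exact hm.integrable_mul (Lp.memLp f)

/-- The Hilbert–Schmidt operator `T_k` on `L²(X, μ)` with integral kernel `k ∈ L²(X × X, μ × μ)`,
`(T_k f)(y) = ∫ k(y, x) f(x) dμ(x)`. -/
def kernelOp (k : Lp ℂ 2 (μ.prod μ)) : Lp ℂ 2 μ →L[ℂ] Lp ℂ 2 μ :=
  LinearMap.mkContinuous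
    { toFun := fun f => (memLp_kernel_integral k f).toLp _
      map_add' := by
        intro f g
        rw [← MemLp.toLp_add]
        refine MemLp.toLp_congr _ _ ?_
        filter_upwards [integrable_kernel_mul k] with y hy
        rw [Pi.add_apply, ← integral_add (hy f) (hy g)]
        refine integral_congr_ae ?_
        filter_upwards [Lp.coeFn_add f g] with x hx
        rw [hx, Pi.add_apply, mul_add]
      map_smul' := by
        intro c f
        rw [RingHom.id_apply, ← MemLp.toLp_const_smul]
        refine MemLp.toLp_congr _ _ (Eventually.of_forall fun y => ?_)
        rw [Pi.smul_apply, ← integral_smul]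
        refine integral_congr_ae ?_
        filter_upwards [Lp.coeFn_smul c f] with x hx
        rw [hx, Pi.smul_apply, smul_eq_mul, smul_eq_mul, mul_left_comm] }
    ‖k‖ (by
      intro f
      rw [LinearMap.coe_mk, AddHom.coe_mk, Lp.norm_toLp, Lp.norm_def, Lp.norm_def,
        ← ENNReal.toReal_mul]
      exact ENNReal.toReal_mono
        (ENNReal.mul_ne_top (Lp.eLpNorm_ne_top k) (Lp.eLpNorm_ne_top f))
        (eLpNorm_kernel_integral_le k f))

lemma kernelOp_ae_eq (k : Lp ℂ 2 (μ.prod μ)) (f : Lp ℂ 2 μ) :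
    kernelOp k f =ᵐ[μ] fun y => ∫ x, k (y, x) * f x ∂μ :=
  MemLp.coeFn_toLp (memLp_kernel_integral k f)

end Kernel

/-! ### The weak* topology and the spaces `𝓢(κ)` -/

/-- The weak* (that is, ultraweak or σ-weak) topology on `𝓑(H)`: the coarsest topology which makes
all the functionals `T ↦ ∑ₙ ⟪ηₙ, T ξₙ⟫` with `∑ₙ ‖ξₙ‖² < ∞` and `∑ₙ ‖ηₙ‖² < ∞` continuous.
These functionals are exactly those induced by the trace class operators. -/
@[reducible]
def weakStarTopology (H : Type*) [NormedAddCommGroup H] [InnerProductSpace ℂ H] :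
    TopologicalSpace (H →L[ℂ] H) :=
  ⨅ (ξ : ℕ → H) (η : ℕ → H) (_ : Summable fun n => ‖ξ n‖ ^ 2) (_ : Summable fun n => ‖η n‖ ^ 2),
    TopologicalSpace.induced (fun T : H →L[ℂ] H => ∑' n, inner ℂ (η n) (T (ξ n))) inferInstance

/-- `𝓢(κ)`: the weak* closure of the set of Hilbert–Schmidt operators `T_k`, where
`k ∈ L²(X × X)` is supported on `κ`. -/
def supportSpace {X : Type*} [MeasurableSpace X] (μ : Measure X) [SFinite μ]
    (κ : Set (X × X)) : Set (Lp ℂ 2 μ →L[ℂ] Lp ℂ 2 μ) :=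
  @closure _ (weakStarTopology (Lp ℂ 2 μ))
    {T | ∃ k : Lp ℂ 2 (μ.prod μ), (∀ᵐ p ∂μ.prod μ, p ∉ κ → k p = 0) ∧ T = kernelOp k}

/-- A positive rank one operator: a positive operator with one-dimensional range. -/
def IsPositiveRankOne {H : Type*} [NormedAddCommGroup H] [InnerProductSpace ℂ H]
    (T : H →L[ℂ] H) : Prop :=
  T.IsPositive ∧ Module.finrank ℂ (LinearMap.range (T : H →ₗ[ℂ] H)) = 1

/-! ### The example on the circle -/

/-- For a subset `E` of a group (written additively), `E* = {(s, t) : t - s ∈ E}`. -/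
def starSet {G : Type*} [AddGroup G] (E : Set G) : Set (G × G) :=
  {p | p.2 - p.1 ∈ E}

instance : Fact ((0 : ℝ) < 2) := ⟨by norm_num⟩

/-- The circle group, realised as `ℝ / 2ℤ`, that is, `(-1, 1]` with addition modulo `2`. -/
abbrev Torus : Type := AddCircle (2 : ℝ)

/-- Normalised Lebesgue (Haar) measure on the circle. -/
abbrev torusMeasure : Measure Torus := AddCircle.haarAddCircle

/-- The image in the circle of
`{0} ∪ ⋃ₙ ([t₂ₙ₊₁, t₂ₙ] ∪ [-t₂ₙ, -t₂ₙ₊₁])`, where `n = 0, 1, 2, …`. -/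
def intervalUnion (t : ℕ → ℝ) : Set Torus :=
  (fun x : ℝ => (x : Torus)) ''
    ({0} ∪ ⋃ n : ℕ, (Icc (t (2 * n + 1)) (t (2 * n)) ∪ Icc (-t (2 * n)) (-t (2 * n + 1))))

end PosDomain

end

/-! Both halves rest on Steinhaus' theorem: `A - A` is a neighbourhood of `0` when `μ A > 0`.

If `α ×ˢ β ⊆ F*` and `e ∈ F` is not interior, then `γ = {s ∈ α : s + e ∈ β}` is null, since
otherwise `e + (γ - γ) ⊆ F` would be a neighbourhood of `e`. With only countably many such `e`, the
ω-interior of `F*` is `(interior F)*` (`isOmegaInterior_starSet`). For regular closed `F` this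
applies to `F` and to `(interior F)ᶜ`, so `F*` is generated by rectangles.

A positive rank one operator in `𝓢(F*)` is a multiple of the projection onto some `e ≠ 0`, and
rectangles missing `F*` annihilate it. A suitable version `A` of the support of `e` then has `A - A
⊆ F`, so `F` is a neighbourhood of `0` (`mem_nhds_zero_of_isPositiveRankOne`). The gaps between the
intervals of `E` prevent this. -/

namespace PosDomain

open scoped Pointwise

/-! ### Marginally null sets. -/

section Marginal

variable {X : Type*} [MeasurableSpace X] {μ : Measure X}

lemma marginallyNull_empty : MarginallyNull μ (∅ : Set (X × X)) :=
  ⟨∅, measure_empty, empty_subset _⟩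

lemma MarginallyNull.iUnion {A : ℕ → Set (X × X)} (h : ∀ n, MarginallyNull μ (A n)) :
    MarginallyNull μ (⋃ n, A n) := by
  choose M hM hA using h
  refine ⟨⋃ n, M n, measure_iUnion_null hM, iUnion_subset fun n p hp => ?_⟩
  rcases hA n hp with h | h
  · exact Or.inl ⟨mem_iUnion_of_mem n h.1, trivial⟩
  · exact Or.inr ⟨trivial, mem_iUnion_of_mem n h.2⟩

lemma marginallyContained_of_subset {A B : Set (X × X)} (h : A ⊆ B) :
    MarginallyContained μ A B := by
  rw [MarginallyContained, sdiff_eq_empty.2 h]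
  exact marginallyNull_empty

lemma marginallyEquiv_refl (A : Set (X × X)) : MarginallyEquiv μ A A := by
  rw [MarginallyEquiv, symmDiff_self]
  exact marginallyNull_empty

end Marginal

lemma exists_iUnion_rectangles {X : Type*} [TopologicalSpace X] [SecondCountableTopology X]
    [MeasurableSpace X] [OpensMeasurableSpace X] {U : Set (X × X)} (hU : IsOpen U) :
    ∃ R : ℕ → Set (X × X), (∀ n, IsRectangle (R n)) ∧ U = ⋃ n, R n := by
  have hB := (TopologicalSpace.isBasis_countableBasis X).prod
    (TopologicalSpace.isBasis_countableBasis X)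
  obtain ⟨S, hS, rfl⟩ := hB.open_eq_sUnion hU
  have hSc : S.Countable := (((TopologicalSpace.countable_countableBasis X).image2
    (TopologicalSpace.countable_countableBasis X) _).mono hS)
  have hrect : ∀ s ∈ S, IsRectangle s := by
    intro s hs
    obtain ⟨u, hu, v, hv, rfl⟩ := hS hs
    exact ⟨u, v, (TopologicalSpace.isOpen_of_mem_countableBasis hu).measurableSet,
      (TopologicalSpace.isOpen_of_mem_countableBasis hv).measurableSet, rfl⟩
  rcases S.eq_empty_or_nonempty with rfl | hne
  · exact ⟨fun _ => ∅, fun _ => ⟨∅, ∅, .empty, .empty, by simp⟩, by simp⟩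
  · obtain ⟨R, rfl⟩ := hSc.exists_eq_range hne
    exact ⟨R, fun n => hrect _ ⟨n, rfl⟩, sUnion_range R⟩

/-! ### The ω-interior and ω-closure of `F*`. -/

section Group

variable {G : Type*} [AddCommGroup G] [TopologicalSpace G] [IsTopologicalAddGroup G]

lemma isOpen_starSet {U : Set G} (hU : IsOpen U) : IsOpen (starSet U) :=
  hU.preimage (continuous_snd.sub continuous_fst)

lemma isClosed_starSet {F : Set G} (hF : IsClosed F) : IsClosed (starSet F) :=
  hF.preimage (continuous_snd.sub continuous_fst)

variable [SecondCountableTopology G] [LocallyCompactSpace G] [MeasurableSpace G] [BorelSpace G]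
  (μ : Measure G) [μ.IsAddHaarMeasure] [μ.InnerRegular]

/-- By Steinhaus' theorem a rectangle contained in `F*` marginally avoids `(F \ interior F)*`
when `F \ interior F` is countable. -/
lemma isOmegaInterior_starSet {F : Set G} (hF : (F \ interior F).Countable) :
    IsOmegaInterior μ (starSet F) (starSet (interior F)) where
  isOmegaOpen := by
    obtain ⟨R, hR, hU⟩ := exists_iUnion_rectangles (isOpen_starSet (isOpen_interior (s := F)))
    exact ⟨R, hR, hU ▸ marginallyEquiv_refl _⟩
  upper := by
    rintro _ ⟨⟨α, β, hα, hβ, rfl⟩, hsub⟩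
    -- First coordinates of the points of the rectangle lying on the lines `t - s = e`, with `e` in
    -- `F` but not interior.
    refine ⟨⋃ e ∈ F \ interior F, α ∩ (fun s => s + e) ⁻¹' β,
      (measure_biUnion_null_iff hF).2 fun e he => ?_, ?_⟩
    · by_contra hpos
      refine he.2 (mem_interior_iff_mem_nhds.2 ?_)
      have hγ : MeasurableSet (α ∩ (fun s => s + e) ⁻¹' β) :=
        hα.inter (measurable_add_const e hβ)
      have hs := Measure.sub_mem_nhds_zero_of_addHaar_pos μ _ hγ (pos_iff_ne_zero.2 hpos)
      have hs' : (fun x => x - e) ⁻¹' ((α ∩ (fun s => s + e) ⁻¹' β) -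
          (α ∩ (fun s => s + e) ⁻¹' β)) ∈ 𝓝 e :=
        (continuous_sub_right e).continuousAt.preimage_mem_nhds (by simpa using hs)
      refine mem_of_superset hs' ?_
      -- For `x` near `e`, `x = (a + e) - b` with `b ∈ α` and `a + e ∈ β`.
      rintro x ⟨a, ha, b, hb, hab⟩
      have : (b, a + e) ∈ starSet F := hsub ⟨hb.1, ha.2⟩
      have hx : a + e - b = x := by
        have : a - b = x - e := hab
        rw [add_sub_right_comm, this, sub_add_cancel]
      rwa [← hx]
    · rintro ⟨s, t⟩ ⟨⟨hs, ht⟩, hst⟩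
      refine Or.inl ⟨mem_biUnion (x := t - s) ⟨hsub ⟨hs, ht⟩, hst⟩ ⟨hs, ?_⟩, trivial⟩
      simpa using ht
  least := by
    intro V _ hV
    obtain ⟨R, hR, hU⟩ := exists_iUnion_rectangles (isOpen_starSet (isOpen_interior (s := F)))
    rw [MarginallyContained, hU, iUnion_sdiff]
    refine MarginallyNull.iUnion fun n => hV _ ⟨hR n, ?_⟩
    have h1 : R n ⊆ starSet (interior F) := hU ▸ subset_iUnion R n
    exact h1.trans fun p hp => interior_subset (s := F) hp

lemma isPositivityDomain_starSet {F : Set G} (hreg : closure (interior F) = F)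
    (hcount : (F \ interior F).Countable) (hneg : ∀ x ∈ F, -x ∈ F) (h0 : (0 : G) ∈ F) :
    IsPositivityDomain μ (starSet F) where
  measurableSet := (isClosed_starSet (hreg ▸ isClosed_closure)).measurableSet
  generatedByRectangles := by
    refine ⟨_, starSet F, isOmegaInterior_starSet μ hcount, ?_, marginallyEquiv_refl _⟩
    -- By regularity `(interior F)ᶜ` has interior `Fᶜ`, so its non-interior points are again `F \
    -- interior F`.
    have h := isOmegaInterior_starSet μ (F := (interior F)ᶜ)
      (by rwa [interior_compl, hreg, sdiff_compl, inter_comm, ← sdiff_eq])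
    rwa [interior_compl, hreg] at h
  symmetric := by
    have : {p : G × G | (p.2, p.1) ∈ starSet F} = starSet F := by
      ext ⟨s, t⟩
      refine ⟨fun h => ?_, fun h => ?_⟩
      · simpa [starSet] using hneg _ h
      · simpa [starSet] using hneg _ h
    rw [this]
    exact marginallyEquiv_refl _
  diagonal := marginallyContained_of_subset fun p hp => by
    rw [mem_diagonal_iff] at hp
    simpa [starSet, hp] using h0

end Group

/-! ### Operators supported on `κ` and rank one operators. -/

section Support

/-- Vector functionals are among those defining the topology: take sequences concentrated at index
`0`. -/
lemma isClosed_inner_eq_zero {H : Type*} [NormedAddCommGroup H] [InnerProductSpace ℂ H]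
    (h f : H) : IsClosed[weakStarTopology H] {T : H →L[ℂ] H | inner ℂ h (T f) = 0} := by
  set ξ : ℕ → H := Pi.single 0 f with hξ
  set η : ℕ → H := Pi.single 0 h with hη
  have hs : ∀ v : H, Summable fun n => ‖(Pi.single 0 v : ℕ → H) n‖ ^ 2 := fun v =>
    summable_of_ne_finset_zero (s := {0}) fun n hn => by
      simp [Pi.single_eq_of_ne (Finset.notMem_singleton.1 hn)]
  have hle : weakStarTopology H ≤ TopologicalSpace.induced
      (fun T : H →L[ℂ] H => ∑' n, inner ℂ (η n) (T (ξ n))) inferInstance :=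
    iInf_le_of_le ξ (iInf_le_of_le η (iInf_le_of_le (hs f) (iInf_le _ (hs h))))
  have heq : ∀ T : H →L[ℂ] H, ∑' n, inner ℂ (η n) (T (ξ n)) = inner ℂ h (T f) := fun T => by
    rw [tsum_eq_single 0 fun n hn => by simp [hη, Pi.single_eq_of_ne hn]]
    simp [hη, hξ]
  simp only [heq] at hle
  have hc : @IsClosed _ (TopologicalSpace.induced
      (fun T : H →L[ℂ] H => (inner ℂ h (T f) : ℂ)) inferInstance)
      {T : H →L[ℂ] H | inner ℂ h (T f) = 0} :=
    isClosed_induced_iff.2 ⟨{0}, isClosed_singleton, rfl⟩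
  exact hc.mono hle

variable {X : Type*} [MeasurableSpace X] {μ : Measure X}

/-- With `f = 1_B g` one has `⟪g, f⟫ = ‖f‖²`. -/
lemma exists_restriction (g : Lp ℂ 2 μ) {B : Set X} (hB : MeasurableSet B) :
    ∃ f : Lp ℂ 2 μ, (∀ᵐ x ∂μ, x ∉ B → f x = 0) ∧
      ((inner ℂ g f : ℂ) = 0 → ∀ᵐ x ∂μ, x ∈ B → g x = 0) := by
  refine ⟨((Lp.memLp g).indicator hB).toLp _, ?_, fun h0 => ?_⟩
  · filter_upwards [((Lp.memLp g).indicator hB).coeFn_toLp] with x hx hxB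
    rw [hx, indicator_of_notMem hxB]
  · have hself : (inner ℂ (((Lp.memLp g).indicator hB).toLp _)
        (((Lp.memLp g).indicator hB).toLp _) : ℂ) = 0 := by
      rw [← h0, L2.inner_def, L2.inner_def]
      refine integral_congr_ae ?_
      filter_upwards [((Lp.memLp g).indicator hB).coeFn_toLp] with x hx
      by_cases hxB : x ∈ B <;> simp [hx, hxB]
    rw [inner_self_eq_zero] at hself
    filter_upwards [((Lp.memLp g).indicator hB).coeFn_toLp, Lp.coeFn_zero ℂ 2 μ] with x hx hz hxB
    rw [hself, hz, indicator_of_mem hxB] at hx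
    exact hx.symm

variable [SFinite μ]

lemma inner_kernelOp_eq_zero {κ : Set (X × X)} {α β : Set X} (hdisj : Disjoint (α ×ˢ β) κ)
    {k : Lp ℂ 2 (μ.prod μ)} (hk : ∀ᵐ p ∂μ.prod μ, p ∉ κ → k p = 0) {h f : Lp ℂ 2 μ}
    (hh : ∀ᵐ y ∂μ, y ∉ α → h y = 0) (hf : ∀ᵐ x ∂μ, x ∉ β → f x = 0) :
    inner ℂ h (kernelOp k f) = 0 := by
  rw [L2.inner_def]
  refine integral_eq_zero_of_ae ?_
  filter_upwards [kernelOp_ae_eq k f, hh, Measure.ae_ae_of_ae_prod hk] with y hy hhy hky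
  by_cases hyα : y ∈ α
  · have : ∫ x, k (y, x) * f x ∂μ = 0 := by
      refine integral_eq_zero_of_ae ?_
      filter_upwards [hf, hky] with x hfx hkx
      by_cases hxβ : x ∈ β
      · simp [hkx (disjoint_left.1 hdisj ⟨hyα, hxβ⟩)]
      · simp [hfx hxβ]
    simp [hy, this]
  · simp [hhy hyα]

lemma inner_eq_zero_of_mem_supportSpace {κ : Set (X × X)} {α β : Set X}
    (hdisj : Disjoint (α ×ˢ β) κ) {T : Lp ℂ 2 μ →L[ℂ] Lp ℂ 2 μ} (hT : T ∈ supportSpace μ κ)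
    {h f : Lp ℂ 2 μ} (hh : ∀ᵐ y ∂μ, y ∉ α → h y = 0) (hf : ∀ᵐ x ∂μ, x ∉ β → f x = 0) :
    inner ℂ h (T f) = 0 := by
  let := weakStarTopology (Lp ℂ 2 μ)
  refine closure_minimal ?_ (isClosed_inner_eq_zero h f) hT
  rintro _ ⟨k, hk, rfl⟩
  exact inner_kernelOp_eq_zero hdisj hk hh hf

end Support

/-- Let `e` span the range, `T f = a e` and `T e = l e`. Symmetry gives `a ⟪e, e⟫ = conj l ⟪e, f⟫`,
whence `c = conj l / ⟪e, e⟫`. It is nonzero because `e` itself is a value of `T`. -/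
lemma IsPositiveRankOne.exists_inner_eq {H : Type*} [NormedAddCommGroup H]
    [InnerProductSpace ℂ H] {T : H →L[ℂ] H} (hT : IsPositiveRankOne T) :
    ∃ (e : H) (c : ℂ), e ≠ 0 ∧ c ≠ 0 ∧ ∀ h f, inner ℂ h (T f) = c * inner ℂ e f * inner ℂ h e := by
  obtain ⟨hpos, hrank⟩ := hT
  obtain ⟨⟨e, he⟩, hne, hspan⟩ := finrank_eq_one_iff'.1 hrank
  have he0 : e ≠ 0 := fun h => hne (Subtype.ext h)
  have hTf : ∀ f, ∃ a : ℂ, a • e = T f := fun f => by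
    obtain ⟨a, ha⟩ := hspan ⟨T f, f, rfl⟩
    exact ⟨a, congrArg Subtype.val ha⟩
  have hee : (inner ℂ e e : ℂ) ≠ 0 := inner_self_ne_zero.2 he0
  obtain ⟨l, hl⟩ := hTf e
  have key : ∀ h f, (inner ℂ h (T f) : ℂ) =
      (starRingEnd ℂ) l / inner ℂ e e * inner ℂ e f * inner ℂ h e := by
    intro h f
    obtain ⟨a, ha⟩ := hTf f
    have h1 : (inner ℂ e (T f) : ℂ) = inner ℂ (T e) f :=
      (hpos.isSymmetric e f).symm
    rw [← ha, ← hl, inner_smul_right, inner_smul_left] at h1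
    rw [← ha, inner_smul_right]
    field_simp
    linear_combination inner ℂ h e * h1
  refine ⟨e, _, he0, fun hc => ?_, key⟩
  obtain ⟨f, hf⟩ := he
  refine he0 (inner_self_eq_zero (𝕜 := ℂ).1 ?_)
  have := key e f
  rw [hc, zero_mul, zero_mul] at this
  rwa [show T f = e from hf] at this

/-- If `F*` supports a positive rank one operator `c e ⊗ e*`, then the support `A` of `e`
essentially satisfies `A - A ⊆ F`, so Steinhaus' theorem makes `F` a neighbourhood of `0`. -/
lemma mem_nhds_zero_of_isPositiveRankOne {G : Type*} [AddCommGroup G] [TopologicalSpace G]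
    [IsTopologicalAddGroup G] [SecondCountableTopology G] [LocallyCompactSpace G]
    [MeasurableSpace G] [BorelSpace G] (μ : Measure G) [μ.IsAddHaarMeasure] [μ.InnerRegular]
    [SFinite μ] {F : Set G} (hF : IsClosed F) (hneg : ∀ x ∈ F, -x ∈ F)
    {T : Lp ℂ 2 μ →L[ℂ] Lp ℂ 2 μ} (hT : T ∈ supportSpace μ (starSet F))
    (hpos : IsPositiveRankOne T) : F ∈ 𝓝 0 := by
  obtain ⟨e, c, he, hc, hinner⟩ := hpos.exists_inner_eq
  -- Testing `T` against `1_U e` and `1_V e` makes a product of two inner products vanish.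
  have hrect : ∀ U V : Set G, MeasurableSet U → MeasurableSet V → Disjoint (U ×ˢ V) (starSet F) →
      (∀ᵐ x ∂μ, x ∈ U → e x = 0) ∨ (∀ᵐ x ∂μ, x ∈ V → e x = 0) := by
    intro U V hU hV hdisj
    obtain ⟨h, hh, hh0⟩ := exists_restriction e hU
    obtain ⟨f, hf, hf0⟩ := exists_restriction e hV
    have h0 := hinner h f
    rw [inner_eq_zero_of_mem_supportSpace hdisj hT hh hf, eq_comm, mul_eq_zero, mul_eq_zero] at h0
    rcases h0 with (h0 | h0) | h0
    · exact absurd h0 hc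
    · exact Or.inr (hf0 h0)
    · exact Or.inl (hh0 (inner_eq_zero_symm.1 h0))
  -- Deleting the basic open sets on which `e` vanishes a.e. costs a null part of the support and
  -- leaves only points each of whose basic neighbourhoods carries mass of `e`.
  set 𝓑 : Set (Set G) := {B ∈ TopologicalSpace.countableBasis G | ∀ᵐ x ∂μ, x ∈ B → e x = 0}
  have h𝓑 : 𝓑.Countable := (TopologicalSpace.countable_countableBasis G).mono fun B hB => hB.1
  have hnull : ∀ᵐ x ∂μ, x ∈ ⋃₀ 𝓑 → e x = 0 := by
    filter_upwards [(ae_ball_iff h𝓑).2 fun B hB => hB.2] with x hx ⟨B, hB, hxB⟩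
    exact hx B hB hxB
  set A : Set G := {x | e x ≠ 0} \ ⋃₀ 𝓑
  have hA : MeasurableSet A := by
    refine MeasurableSet.diff ?_ (isOpen_sUnion fun B hB =>
      TopologicalSpace.isOpen_of_mem_countableBasis hB.1).measurableSet
    exact ((Lp.stronglyMeasurable e).measurable (measurableSet_singleton 0)).compl
  have hApos : 0 < μ A := by
    refine pos_iff_ne_zero.2 fun h0 => he ((Lp.eq_zero_iff_ae_eq_zero).2 ?_)
    filter_upwards [hnull, measure_eq_zero_iff_ae_notMem.1 h0] with x hx hxA
    by_contra hne
    exact hxA ⟨hne, fun hxB => hne (hx hxB)⟩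
  refine mem_of_superset (Measure.sub_mem_nhds_zero_of_addHaar_pos μ A hA hApos) ?_
  rintro _ ⟨a, ha, b, hb, rfl⟩
  by_contra hab
  have hmem : (a, b) ∈ (starSet F)ᶜ := fun h => hab (by simpa using hneg _ h)
  -- As `F*` is closed, a basic open rectangle around `(a, b)` misses it; `e` then vanishes a.e.
  -- near `a` or near `b`.
  obtain ⟨_, ⟨U, hU, V, hV, rfl⟩, ⟨haU, hbV⟩, hsub⟩ :=
    ((TopologicalSpace.isBasis_countableBasis G).prod
      (TopologicalSpace.isBasis_countableBasis G)).exists_subset_of_mem_open hmem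
      (isClosed_starSet hF).isOpen_compl
  rcases hrect U V (TopologicalSpace.isOpen_of_mem_countableBasis hU).measurableSet
    (TopologicalSpace.isOpen_of_mem_countableBasis hV).measurableSet
    (disjoint_left.2 fun p hp => hsub hp) with h | h
  · exact ha.2 ⟨U, ⟨hU, h⟩, haU⟩
  · exact hb.2 ⟨V, ⟨hV, h⟩, hbV⟩

/-! ### Topology of the set `E` on the line and on the circle. -/

section IntervalUnion

variable {t : ℕ → ℝ}

/-- The subset of the line whose image in the circle is `intervalUnion t`. -/
def realIntervalUnion (t : ℕ → ℝ) : Set ℝ :=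
  {0} ∪ ⋃ n : ℕ, (Icc (t (2 * n + 1)) (t (2 * n)) ∪ Icc (-t (2 * n)) (-t (2 * n + 1)))

lemma mem_realIntervalUnion {x : ℝ} : x ∈ realIntervalUnion t ↔
    x = 0 ∨ ∃ n, x ∈ Icc (t (2 * n + 1)) (t (2 * n)) ∨ x ∈ Icc (-t (2 * n)) (-t (2 * n + 1)) := by
  simp [realIntervalUnion]

lemma neg_mem_realIntervalUnion {x : ℝ} (hx : x ∈ realIntervalUnion t) :
    -x ∈ realIntervalUnion t := by
  rw [mem_realIntervalUnion] at hx ⊢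
  rcases hx with rfl | ⟨n, h | h⟩
  · simp
  · exact Or.inr ⟨n, Or.inr ⟨neg_le_neg h.2, neg_le_neg h.1⟩⟩
  · exact Or.inr ⟨n, Or.inl ⟨le_neg.2 h.2, neg_le.2 h.1⟩⟩

lemma abs_lt_one_of_mem_realIntervalUnion (ht : ∀ n, t n ∈ Ioo (0 : ℝ) 1) {x : ℝ}
    (hx : x ∈ realIntervalUnion t) : |x| < 1 := by
  rcases mem_realIntervalUnion.1 hx with rfl | ⟨n, h | h⟩
  · simp
  all_goals
    have h1 := ht (2 * n)
    have h2 := ht (2 * n + 1)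
    rw [abs_lt]
    constructor <;> linarith [h.1, h.2, h1.1, h1.2, h2.1, h2.2]

lemma isClosed_realIntervalUnion (hmono : StrictAnti t) (ht : ∀ n, t n ∈ Ioo (0 : ℝ) 1)
    (hlim : Tendsto t atTop (𝓝 0)) : IsClosed (realIntervalUnion t) := by
  -- The intervals accumulate only at `0`: the `N`-th approximant keeps the first `N` pairs and
  -- fills in `[-t (2N), t (2N)]`.
  have heq : realIntervalUnion t = ⋂ N : ℕ, (Icc (-t (2 * N)) (t (2 * N)) ∪
      ⋃ n ∈ Finset.range N,
        (Icc (t (2 * n + 1)) (t (2 * n)) ∪ Icc (-t (2 * n)) (-t (2 * n + 1)))) := by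
    ext x
    rw [mem_realIntervalUnion, mem_iInter]
    constructor
    · rintro (rfl | ⟨n, h⟩) N
      · exact Or.inl ⟨by linarith [(ht (2 * N)).1], (ht _).1.le⟩
      · rcases lt_or_ge n N with hn | hn
        · exact Or.inr (mem_biUnion (Finset.mem_coe.2 (Finset.mem_range.2 hn)) h)
        · have h1 := hmono.antitone (by lia : 2 * N ≤ 2 * n)
          have h2 := (ht (2 * n + 1)).1
          have h3 := (ht (2 * N)).1
          refine Or.inl ?_
          rcases h with h | h <;> constructor <;> linarith [h.1, h.2]
    · intro h
      by_cases hx : x = 0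
      · exact Or.inl hx
      · obtain ⟨N, hN⟩ := (hlim.eventually_lt_const (abs_pos.2 hx)).exists
        rcases h N with h | h
        · have h1 := hmono.antitone (by lia : N ≤ 2 * N)
          exact absurd (abs_le.2 h) (by linarith)
        · obtain ⟨n, -, hn⟩ := mem_iUnion₂.1 h
          exact Or.inr ⟨n, hn⟩
  rw [heq]
  exact isClosed_iInter fun N => isClosed_Icc.union
    (isClosed_biUnion_finset fun n _ => isClosed_Icc.union isClosed_Icc)

lemma isClosed_intervalUnion (hmono : StrictAnti t) (ht : ∀ n, t n ∈ Ioo (0 : ℝ) 1)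
    (hlim : Tendsto t atTop (𝓝 0)) : IsClosed (intervalUnion t) := by
  have hcomp : IsCompact (realIntervalUnion t) :=
    isCompact_Icc.of_isClosed_subset (isClosed_realIntervalUnion hmono ht hlim) fun x hx =>
      abs_le.1 (abs_lt_one_of_mem_realIntervalUnion ht hx).le
  exact (hcomp.image (AddCircle.continuous_mk' 2)).isClosed

lemma coe_mem_interior_intervalUnion {a b x : ℝ} (hab : Icc a b ⊆ realIntervalUnion t)
    (hx : x ∈ Ioo a b) : (x : Torus) ∈ interior (intervalUnion t) := by
  have hopen : IsOpen ((fun x : ℝ => (x : Torus)) '' Ioo a b) :=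
    QuotientAddGroup.isOpenMap_coe _ isOpen_Ioo
  exact interior_maximal (image_mono (Ioo_subset_Icc_self.trans hab)) hopen ⟨x, hx, rfl⟩

/-- Only `0` and the endpoints `± t n` can fail to be interior. -/
lemma countable_intervalUnion_sdiff_interior :
    (intervalUnion t \ interior (intervalUnion t)).Countable := by
  have hc : ({0} ∪ (range t ∪ range fun n => -t n) : Set ℝ).Countable :=
    (countable_singleton 0).union ((countable_range _).union (countable_range _))
  refine (hc.image fun x : ℝ => (x : Torus)).mono ?_
  rintro _ ⟨⟨x, hx, rfl⟩, hni⟩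
  refine ⟨x, ?_, rfl⟩
  by_contra hcon
  simp only [mem_union, mem_singleton_iff, mem_range, not_or, not_exists] at hcon
  obtain ⟨h0, h1, h2⟩ := hcon
  rcases mem_realIntervalUnion.1 hx with rfl | ⟨n, h | h⟩
  · exact h0 rfl
  · exact hni (coe_mem_interior_intervalUnion
      (fun y hy => mem_realIntervalUnion.2 (Or.inr ⟨n, Or.inl hy⟩))
      ⟨lt_of_le_of_ne h.1 (h1 _), lt_of_le_of_ne h.2 (Ne.symm (h1 _))⟩)
  · exact hni (coe_mem_interior_intervalUnion
      (fun y hy => mem_realIntervalUnion.2 (Or.inr ⟨n, Or.inr hy⟩))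
      ⟨lt_of_le_of_ne h.1 (h2 _), lt_of_le_of_ne h.2 (Ne.symm (h2 _))⟩)

lemma closure_interior_intervalUnion (hmono : StrictAnti t) (ht : ∀ n, t n ∈ Ioo (0 : ℝ) 1)
    (hlim : Tendsto t atTop (𝓝 0)) :
    closure (interior (intervalUnion t)) = intervalUnion t := by
  refine (closure_minimal interior_subset (isClosed_intervalUnion hmono ht hlim)).antisymm ?_
  have hcont : Continuous fun x : ℝ => (x : Torus) := AddCircle.continuous_mk' 2
  have hIcc : ∀ a b : ℝ, a < b → Icc a b ⊆ realIntervalUnion t → ∀ x ∈ Icc a b,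
      (x : Torus) ∈ closure (interior (intervalUnion t)) := by
    intro a b hab hsub x hx
    rw [← closure_Ioo hab.ne] at hx
    refine map_mem_closure hcont hx fun y hy => coe_mem_interior_intervalUnion hsub hy
  have hpos : ∀ n, ∀ x ∈ Icc (t (2 * n + 1)) (t (2 * n)),
      (x : Torus) ∈ closure (interior (intervalUnion t)) := fun n =>
    hIcc _ _ (hmono (by lia)) fun y hy => mem_realIntervalUnion.2 (Or.inr ⟨n, Or.inl hy⟩)
  rintro _ ⟨x, hx, rfl⟩
  rcases mem_realIntervalUnion.1 hx with rfl | ⟨n, h | h⟩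
  · have hsub : Tendsto (fun n : ℕ => 2 * n) atTop atTop :=
      tendsto_atTop_mono (fun n => by rw [id]; lia) tendsto_id
    exact isClosed_closure.mem_of_tendsto ((hcont.tendsto 0).comp (hlim.comp hsub))
      (Eventually.of_forall fun n => hpos n _ ⟨(hmono (by lia)).le, le_rfl⟩)
  · exact hpos n x h
  · exact hIcc _ _ (neg_lt_neg (hmono (by lia)))
      (fun y hy => mem_realIntervalUnion.2 (Or.inr ⟨n, Or.inr hy⟩)) x h

/-- The projection to the circle is injective on `[-1, 1)`. -/
lemma mem_realIntervalUnion_of_coe_mem (ht : ∀ n, t n ∈ Ioo (0 : ℝ) 1) {x : ℝ} (hx : |x| < 1)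
    (h : (x : Torus) ∈ intervalUnion t) : x ∈ realIntervalUnion t := by
  obtain ⟨y, hy, hyx⟩ := h
  have hy1 := abs_lt.1 (abs_lt_one_of_mem_realIntervalUnion ht hy)
  have hx1 := abs_lt.1 hx
  have := (AddCircle.coe_eq_coe_iff_of_mem_Ico (p := (2 : ℝ)) (a := -1)
    ⟨hy1.1.le, by linarith [hy1.2]⟩ ⟨hx1.1.le, by linarith [hx1.2]⟩).1 hyx
  rwa [← this]

lemma intervalUnion_notMem_nhds (hmono : StrictAnti t) (ht : ∀ n, t n ∈ Ioo (0 : ℝ) 1)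
    (hlim : Tendsto t atTop (𝓝 0)) : intervalUnion t ∉ 𝓝 (0 : Torus) := by
  intro hnhds
  -- Midpoints of the gaps `(t (2n+2), t (2n+1))`, which tend to `0` outside `E`.
  set m : ℕ → ℝ := fun n => (t (2 * n + 1) + t (2 * n + 2)) / 2
  have hm : Tendsto m atTop (𝓝 0) := by
    have h1 : Tendsto (fun n : ℕ => t (2 * n + 1)) atTop (𝓝 0) :=
      hlim.comp (tendsto_atTop_mono (fun n => by rw [id]; lia) tendsto_id)
    have h2 : Tendsto (fun n : ℕ => t (2 * n + 2)) atTop (𝓝 0) :=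
      hlim.comp (tendsto_atTop_mono (fun n => by rw [id]; lia) tendsto_id)
    simpa using (h1.add h2).div_const 2
  have hcoe : Tendsto (fun n => (m n : Torus)) atTop (𝓝 0) :=
    ((AddCircle.continuous_mk' (2 : ℝ)).tendsto 0).comp hm
  obtain ⟨n, hn⟩ := (hcoe.eventually_mem hnhds).exists
  have hlt : t (2 * n + 2) < t (2 * n + 1) := hmono (by lia)
  have h1 := ht (2 * n + 1)
  have h2 := ht (2 * n + 2)
  have hm1 : t (2 * n + 2) < m n := by simp only [m]; linarith
  have hm2 : m n < t (2 * n + 1) := by simp only [m]; linarith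
  have hmem := mem_realIntervalUnion_of_coe_mem ht
    (abs_lt.2 ⟨by linarith [h2.1], by linarith [h1.2]⟩) hn
  rcases mem_realIntervalUnion.1 hmem with h | ⟨k, h | h⟩
  · linarith [h2.1]
  · rcases le_or_gt k n with hk | hk
    · linarith [h.1, hmono.antitone (by lia : 2 * k + 1 ≤ 2 * n + 1)]
    · linarith [h.2, hmono.antitone (by lia : 2 * n + 2 ≤ 2 * k)]
  · linarith [h.2, (ht (2 * k + 1)).1, h2.1]

lemma neg_mem_intervalUnion {x : Torus} (hx : x ∈ intervalUnion t) : -x ∈ intervalUnion t := by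
  obtain ⟨y, hy, rfl⟩ := hx
  exact ⟨-y, neg_mem_realIntervalUnion hy, AddCircle.coe_neg 2⟩

lemma zero_mem_intervalUnion : (0 : Torus) ∈ intervalUnion t :=
  ⟨0, mem_realIntervalUnion.2 (Or.inl rfl), AddCircle.coe_zero 2⟩

end IntervalUnion

/-! ### The example on the circle. -/

lemma isAddHaarMeasure_torusMeasure : Measure.IsAddHaarMeasure torusMeasure :=
  inferInstanceAs (Measure.IsAddHaarMeasure (Measure.addHaarMeasure ⊤))

theorem intervalUnion_example (t : ℕ → ℝ) (hmono : StrictAnti t)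
    (ht : ∀ n, t n ∈ Ioo (0 : ℝ) 1) (hlim : Tendsto t atTop (𝓝 0)) :
    intervalUnion t ∉ 𝓝 (0 : Torus) ∧
      IsPositivityDomain torusMeasure (starSet (intervalUnion t)) ∧
      ∀ T ∈ supportSpace torusMeasure (starSet (intervalUnion t)), ¬ IsPositiveRankOne T := by
  have := isAddHaarMeasure_torusMeasure
  have hnot := intervalUnion_notMem_nhds hmono ht hlim
  exact ⟨hnot, isPositivityDomain_starSet _ (closure_interior_intervalUnion hmono ht hlim)
      countable_intervalUnion_sdiff_interior (fun _ => neg_mem_intervalUnion)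
      zero_mem_intervalUnion,
    fun T hT hpos => hnot (mem_nhds_zero_of_isPositiveRankOne _
      (isClosed_intervalUnion hmono ht hlim) (fun _ => neg_mem_intervalUnion) hT hpos)⟩

end PosDomain

theorem mainTheorem9 :
    (∃ κ : Set (PosDomain.Torus × PosDomain.Torus),
      PosDomain.IsPositivityDomain PosDomain.torusMeasure κ ∧
      ∀ T ∈ PosDomain.supportSpace PosDomain.torusMeasure κ, ¬ PosDomain.IsPositiveRankOne T) ∧
    ∀ t : ℕ → ℝ, StrictAnti t → (∀ n, t n ∈ Set.Ioo (0 : ℝ) 1) →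
      Filter.Tendsto t Filter.atTop (nhds 0) →
      PosDomain.intervalUnion t ∉ nhds (0 : PosDomain.Torus) ∧
      PosDomain.IsPositivityDomain PosDomain.torusMeasure
        (PosDomain.starSet (PosDomain.intervalUnion t)) ∧
      ∀ T ∈ PosDomain.supportSpace PosDomain.torusMeasure
        (PosDomain.starSet (PosDomain.intervalUnion t)), ¬ PosDomain.IsPositiveRankOne T := by
  refine ⟨?_, PosDomain.intervalUnion_example⟩
  -- The sequence `1 / (n + 2)`, shifted so that its term at `n = 0` is below `1`.
  have h := PosDomain.intervalUnion_example (fun n => 1 / ((n : ℝ) + 1 + 1))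
    (fun m n hmn => one_div_lt_one_div_of_lt (by positivity) (by gcongr))
    (fun n => ⟨by positivity, (div_lt_one (by positivity)).2 (by
      have : (0 : ℝ) ≤ n := n.cast_nonneg
      linarith)⟩)
    (by
      have := (Filter.tendsto_add_atTop_iff_nat 1).2
        (tendsto_one_div_add_atTop_nhds_zero_nat (𝕜 := ℝ))
      simpa using this)
  exact ⟨_, h.2⟩
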